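/- Let $n \ge 2$ be an integer and let $A = (A_1, \dots, A_n)$ be a contractive $n$-tuple of bounded operators on a complex Hilbert space $\mathcal H$, i.e. $\sum_{i=1}^n A_i A_i^* \le I$. For an $n$-tuple $B=(B_1,\dots,B_n)$ of operators put $\Phi_B(X) = \sum_{i=1}^n B_i X B_i^*$, and for contractive $B$ define the curvature invariant and the Euler characteristic, with values in $[0,\infty]$, by $$K(B) = (n-1)\lim_{k\to\infty} \frac{\operatorname{tr}(I-\Phi_B^k(I))}{n^k}, \qquad \chi(B) = (n-1)\lim_{k\to\infty} \frac{\operatorname{rk}(I-\Phi_B^k(I))}{n^k}.$$ Let $S = (S_1,\dots,S_n)$, acting on a Hilbert space $\mathcal K \supseteq \mathcal H$, be the minimal isometric dilation of $A$: $S_i^*S_j = \delta_{ij} I$ for all $i,j$; for every word $w = i_1\cdots i_d$ in $\{1,\dots,n\}$ the operator $A_w = A_{i_1}\cdots A_{i_d}$ is the compression to $\mathcal H$ of $S_w = S_{i_1}\cdots S_{i_d}$; and the closed linear span of the subspaces $S_w\mathcal H$ is $\mathcal K$. This dilation is unique up to unitary equivalence fixing $\mathcal H$, and the pure rank of $A$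 is defined as $\operatorname{pure\,rank}(A) = \operatorname{rk}\bigl(I - \sum_{i=1}^n S_iS_i^*\bigr) \in \{0,1,2,\dots,\infty\}$. Then the limits defining $K(A)$, $K(S)$, $\chi(A)$ and $\chi(S)$ exist in $[0,\infty]$, and (i) $K(A) \le K(S) = \operatorname{pure\,rank}(A)$, and (ii) $\chi(A) \le \chi(S) = \operatorname{pure\,rank}(A)$. -/

import Mathlib

open Filter Topology
open scoped ENNReal InnerProductSpace

universe u

noncomputable section

namespace RowContraction

open ContinuousLinearMap

section Operators

variable {H : Type u} [NormedAddCommGroup H] [InnerProductSpace ℂ H] [CompleteSpace H]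

/-- The trace, with values in `[0, ∞]`, of a positive bounded operator `T` on `H`: the sum of the
diagonal entries `⟪e, T e⟫` over an orthonormal basis of `H`. For positive `T` this does not
depend on the basis, see `trace_eq_tsum`. -/
def trace (T : H →L[ℂ] H) : ℝ≥0∞ :=
  ∑' e : (exists_hilbertBasis ℂ H).choose,
    ENNReal.ofReal (RCLike.re ⟪(e : H), T (e : H)⟫_ℂ)

theorem ofReal_norm_sq_eq_tsum {ι : Type*} (b : HilbertBasis ι ℂ H) (x : H) :
    ENNReal.ofReal (‖x‖ ^ 2) = ∑' i, ENNReal.ofReal (‖⟪b i, x⟫_ℂ‖ ^ 2) := by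
  have h2 : HasSum (fun i => ‖⟪b i, x⟫_ℂ‖ ^ 2) (‖x‖ ^ 2) := by
    have h3 := RCLike.hasSum_re ℂ (b.hasSum_inner_mul_inner x x)
    rw [inner_self_eq_norm_sq] at h3
    convert h3 using 2 with i
    rw [← inner_conj_symm x (b i), RCLike.conj_mul]
    norm_cast
  rw [← h2.tsum_eq, ENNReal.ofReal_tsum_of_nonneg (fun i => by positivity) h2.summable]

theorem tsum_diag_eq {ι κ : Type*} (b : HilbertBasis ι ℂ H) (c : HilbertBasis κ ℂ H)
    {T : H →L[ℂ] H} (hT : 0 ≤ T) :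
    ∑' i, ENNReal.ofReal (RCLike.re ⟪b i, T (b i)⟫_ℂ) =
      ∑' j, ENNReal.ofReal (RCLike.re ⟪c j, T (c j)⟫_ℂ) := by
  obtain ⟨R, hRs, hR⟩ : ∃ R : H →L[ℂ] H, adjoint R = R ∧ R * R = T := by
    refine ⟨CFC.sqrt T, ?_, CFC.sqrt_mul_sqrt_self T hT⟩
    have h1 : IsSelfAdjoint (CFC.sqrt T) := (CFC.sqrt_nonneg T).isSelfAdjoint
    exact h1.star_eq
  have hsymm : ∀ x y : H, ⟪R x, y⟫_ℂ = ⟪x, R y⟫_ℂ := by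
    intro x y
    rw [← adjoint_inner_right, hRs]
  have diag : ∀ x : H, RCLike.re ⟪x, T x⟫_ℂ = ‖R x‖ ^ 2 := by
    intro x
    rw [← hR, show (R * R) x = R (R x) from rfl, ← hsymm, inner_self_eq_norm_sq]
  simp_rw [diag]
  rw [tsum_congr fun i => ofReal_norm_sq_eq_tsum c (R (b i)),
    tsum_congr fun j => ofReal_norm_sq_eq_tsum b (R (c j)), ENNReal.tsum_comm]
  refine tsum_congr fun j => tsum_congr fun i => ?_
  rw [← hsymm, norm_inner_symm]

theorem trace_eq_tsum {ι : Type*} (b : HilbertBasis ι ℂ H) {T : H →L[ℂ] H} (hT : 0 ≤ T) :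
    trace T = ∑' i, ENNReal.ofReal (RCLike.re ⟪b i, T (b i)⟫_ℂ) := by
  obtain ⟨c, hc⟩ := (exists_hilbertBasis ℂ H).choose_spec
  rw [tsum_diag_eq b c hT, trace, hc]

/-- The rank (dimension of the range) of a bounded operator, in `{0, 1, 2, …, ∞}`. -/
def rank (T : H →L[ℂ] H) : ℕ∞ :=
  Cardinal.toENat (LinearMap.rank (T : H →ₗ[ℂ] H))

variable {n : ℕ}

/-- The completely positive map `Φ_A(X) = ∑ i, A_i X A_i*` of an `n`-tuple `A`. -/
def Phi (A : Fin n → H →L[ℂ] H) (X : H →L[ℂ] H) : H →L[ℂ] H :=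
  ∑ i, A i * X * adjoint (A i)

/-- `A` is a contractive `n`-tuple (row contraction): `∑ i, A_i A_i* ≤ I`. -/
def IsContractive (A : Fin n → H →L[ℂ] H) : Prop :=
  ∑ i, A i * adjoint (A i) ≤ 1

/-- `A_w = A_{i₁} ⋯ A_{i_d}` for a word `w = i₁ ⋯ i_d`; the empty word gives `I`. -/
def wordOp (A : Fin n → H →L[ℂ] H) (w : List (Fin n)) : H →L[ℂ] H :=
  (w.map A).prod

/-- The `k`-th defect operator `I - Φ_A^k(I)`. -/
def defect (A : Fin n → H →L[ℂ] H) (k : ℕ) : H →L[ℂ] H :=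
  1 - (Phi A)^[k] 1

/-- `(n - 1) tr(I - Φ_A^k(I)) / n^k`, in `[0, ∞]`. -/
def curvatureSeq (A : Fin n → H →L[ℂ] H) (k : ℕ) : ℝ≥0∞ :=
  ((n - 1 : ℕ) : ℝ≥0∞) * (trace (defect A k) / (n : ℝ≥0∞) ^ k)

/-- `(n - 1) rk(I - Φ_A^k(I)) / n^k`, in `[0, ∞]`. -/
def eulerSeq (A : Fin n → H →L[ℂ] H) (k : ℕ) : ℝ≥0∞ :=
  ((n - 1 : ℕ) : ℝ≥0∞) * ((rank (defect A k) : ℝ≥0∞) / (n : ℝ≥0∞) ^ k)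

/-- The curvature invariant `K(A) = (n - 1) lim_k tr(I - Φ_A^k(I)) / n^k`, in `[0, ∞]`. -/
def curvature (A : Fin n → H →L[ℂ] H) : ℝ≥0∞ :=
  limUnder atTop (curvatureSeq A)

/-- The Euler characteristic `χ(A) = (n - 1) lim_k rk(I - Φ_A^k(I)) / n^k`, in `[0, ∞]`. -/
def eulerChar (A : Fin n → H →L[ℂ] H) : ℝ≥0∞ :=
  limUnder atTop (eulerSeq A)

end Operators

section Dilation

variable {H : Type u} [NormedAddCommGroup H] [InnerProductSpace ℂ H] [CompleteSpace H]
variable {n : ℕ}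

/-- `S`, acting on `K`, is a minimal isometric dilation of `A`, acting on `H`, where `H` is
regarded as a subspace of `K` through the linear isometry `V`. -/
structure IsMinimalIsometricDilation {K : Type u} [NormedAddCommGroup K]
    [InnerProductSpace ℂ K] [CompleteSpace K]
    (A : Fin n → H →L[ℂ] H) (S : Fin n → K →L[ℂ] K) (V : H →ₗᵢ[ℂ] K) : Prop where
  /-- The `S_i` are isometries with pairwise orthogonal ranges: `S_i* S_j = δ_ij I`. -/
  isometric : ∀ i j, adjoint (S i) * S j = if i = j then 1 else 0
  /-- `A_w` is the compression to `H` of `S_w`, for every word `w`. -/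
  compression : ∀ w : List (Fin n),
    adjoint V.toContinuousLinearMap ∘L wordOp S w ∘L V.toContinuousLinearMap = wordOp A w
  /-- The closed linear span of the subspaces `S_w H` is all of `K`. -/
  minimal : (Submodule.span ℂ
    {x : K | ∃ (w : List (Fin n)) (h : H), x = wordOp S w (V h)}).topologicalClosure = ⊤

/-- The pure rank of a contractive `n`-tuple `A`: the rank of `I - ∑ i, S_i S_i*`, where `S` is
the minimal isometric dilation of `A`. The dilation is unique up to unitary equivalence, so
that the supremum is over a set with one element. -/
def pureRank (A : Fin n → H →L[ℂ] H) : ℕ∞ :=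
  sSup {r : ℕ∞ | ∃ (K : Type u) (_ : NormedAddCommGroup K) (_ : InnerProductSpace ℂ K)
    (_ : CompleteSpace K) (S : Fin n → K →L[ℂ] K) (V : H →ₗᵢ[ℂ] K),
    IsMinimalIsometricDilation A S V ∧ r = rank (1 - ∑ i, S i * adjoint (S i))}

end Dilation

end RowContraction

end

/-! Put `D_k = I - Φ^k(I)`. Since `D_{k+1} = D_1 + Φ(D_k)` with both summands positive, `t_k = tr
D_k` and `t_k = rk D_k` satisfy `t_1 ≤ t_{k+1} ≤ t_1 + n t_k`, and this alone makes `(n-1) t_k /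
n^k` converge (`exists_tendsto_of_le_add_mul`). For `S` the defects are projections, so trace and
rank agree, and the upper bound is an equality; both limits equal `rk D_1(S)` (`curvature_eq_rank`).
As `H` is invariant under the `S_i*`, `D_k(A)` is the compression of `D_k(S)` (`conj_defect`), and
compression increases neither trace nor rank; this gives both inequalities. Minimality gives `rk
D_1(S) = rk D_1(A)` (`rank_defect_one`), so the rank in `pureRank` is the same for every minimal
dilation. -/

namespace RowContraction

open ContinuousLinearMap

/-! ### Limits from the recursion, in `[0, ∞]` -/

section Sequences

theorem tendsto_div_pow {n : ℕ} (hn : 2 ≤ n) {c : ℝ≥0∞} (hc : c ≠ ⊤) :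
    Tendsto (fun k => c / (n : ℝ≥0∞) ^ k) atTop (𝓝 0) := by
  have h1 : Tendsto (fun k => ((n : ℝ≥0∞)⁻¹) ^ k) atTop (𝓝 0) :=
    ENNReal.tendsto_pow_atTop_nhds_zero_of_lt_one (ENNReal.inv_lt_one.2 (by exact_mod_cast hn))
  have h2 := ENNReal.Tendsto.const_mul (a := c) h1 (Or.inr hc)
  simpa [div_eq_mul_inv, ENNReal.inv_pow] using h2

/-- With `m = n - 1`, the recursion gives `m t_{k+1} + t_1 ≤ n (m t_k + t_1)`, so `(m t_k + t_1) /
n^k` decreases, while the correction `t_1 / n^k` tends to `0`. -/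
theorem exists_tendsto_of_le_add_mul {n : ℕ} (hn : 2 ≤ n) {t : ℕ → ℝ≥0∞}
    (h : ∀ k, t (k + 1) ≤ t 1 + n * t k) (h1 : ∀ k, t 1 ≤ t (k + 1)) :
    ∃ l, Tendsto (fun k => ((n - 1 : ℕ) : ℝ≥0∞) * (t k / (n : ℝ≥0∞) ^ k)) atTop (𝓝 l) := by
  have hn0 : (n : ℝ≥0∞) ≠ 0 := by simp; omega
  have hnt : (n : ℝ≥0∞) ≠ ⊤ := ENNReal.natCast_ne_top n
  have hm0 : ((n - 1 : ℕ) : ℝ≥0∞) ≠ 0 := Nat.cast_ne_zero.2 (by omega)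
  have hmn : ((n - 1 : ℕ) : ℝ≥0∞) + 1 = n := by
    exact_mod_cast Nat.sub_add_cancel (show 1 ≤ n by omega)
  generalize ((n - 1 : ℕ) : ℝ≥0∞) = m at *
  by_cases ht : t 1 = ⊤
  · refine ⟨⊤, tendsto_const_nhds.congr' ?_⟩
    -- The hypotheses say nothing about `t 0` being infinite, so `k = 0` is left out.
    filter_upwards [eventually_ge_atTop 1] with k hk
    obtain ⟨j, rfl⟩ := Nat.exists_eq_add_of_le' hk
    have : t (j + 1) = ⊤ := top_le_iff.1 (ht ▸ h1 j)
    rw [this, ENNReal.top_div_of_ne_top (ENNReal.pow_ne_top hnt), ENNReal.mul_top hm0]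
  · have hanti : Antitone fun k => (m * t k + t 1) / (n : ℝ≥0∞) ^ k := by
      refine antitone_nat_of_succ_le fun k => ?_
      rw [pow_succ', ← ENNReal.mul_div_mul_left (m * t k + t 1) _ hn0 hnt]
      refine ENNReal.div_le_div_right ?_ _
      calc m * t (k + 1) + t 1 ≤ m * (t 1 + n * t k) + t 1 := by gcongr; exact h k
        _ = (m + 1) * t 1 + n * (m * t k) := by ring
        _ = n * (m * t k + t 1) := by rw [hmn]; ring
    have hv := tendsto_div_pow hn ht
    have h4 := ENNReal.Tendsto.sub (tendsto_atTop_iInf hanti) hv (Or.inr ENNReal.zero_ne_top)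
    refine ⟨_, h4.congr fun k => ?_⟩
    rw [ENNReal.add_div, ENNReal.add_sub_cancel_right, mul_div_assoc]
    exact (ENNReal.div_lt_top ht (pow_ne_zero _ hn0)).ne

/-- For finite `r` the recursion solves to `m t_k + r = n^k r`, so the sequence is `r - r / n^k`. -/
theorem tendsto_of_eq_add_mul {n : ℕ} (hn : 2 ≤ n) {t : ℕ → ℝ≥0∞} {r : ℝ≥0∞}
    (h0 : t 0 = 0) (h : ∀ k, t (k + 1) = r + n * t k) :
    Tendsto (fun k => ((n - 1 : ℕ) : ℝ≥0∞) * (t k / (n : ℝ≥0∞) ^ k)) atTop (𝓝 r) := by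
  have hn0 : (n : ℝ≥0∞) ≠ 0 := by simp; omega
  have hnt : (n : ℝ≥0∞) ≠ ⊤ := ENNReal.natCast_ne_top n
  have hm0 : ((n - 1 : ℕ) : ℝ≥0∞) ≠ 0 := Nat.cast_ne_zero.2 (by omega)
  have hmn : ((n - 1 : ℕ) : ℝ≥0∞) + 1 = n := by
    exact_mod_cast Nat.sub_add_cancel (show 1 ≤ n by omega)
  generalize ((n - 1 : ℕ) : ℝ≥0∞) = m at *
  by_cases ht : r = ⊤
  · refine tendsto_const_nhds.congr' ?_
    filter_upwards [eventually_ge_atTop 1] with k hk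
    obtain ⟨j, rfl⟩ := Nat.exists_eq_add_of_le' hk
    rw [h, ht, top_add, ENNReal.top_div_of_ne_top (ENNReal.pow_ne_top hnt), ENNReal.mul_top hm0]
  · have hsum : ∀ k, m * t k + r = n ^ k * r := by
      intro k
      induction k with
      | zero => simp [h0]
      | succ k ih =>
        calc m * t (k + 1) + r = (m + 1) * r + n * (m * t k) := by rw [h]; ring
          _ = n * (m * t k + r) := by rw [hmn]; ring
          _ = n ^ (k + 1) * r := by rw [ih]; ring
    have hv := tendsto_div_pow hn ht
    have h4 := ENNReal.Tendsto.sub (tendsto_const_nhds (x := r)) hv (Or.inl ht)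
    rw [tsub_zero] at h4
    refine h4.congr fun k => ?_
    have hp0 : (n : ℝ≥0∞) ^ k ≠ 0 := pow_ne_zero _ hn0
    have hr : r = m * (t k / (n : ℝ≥0∞) ^ k) + r / (n : ℝ≥0∞) ^ k := by
      rw [← mul_div_assoc, ← ENNReal.add_div, hsum, mul_comm,
        ENNReal.mul_div_cancel_right hp0 (ENNReal.pow_ne_top hnt)]
    conv_lhs => rw [hr]
    rw [← hr, ENNReal.sub_eq_of_eq_add (ENNReal.div_lt_top ht hp0).ne hr]

end Sequences

/-! ### Trace and rank of positive operators -/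

section TraceRank

variable {E F : Type u} [NormedAddCommGroup E] [InnerProductSpace ℂ E] [CompleteSpace E]
variable [NormedAddCommGroup F] [InnerProductSpace ℂ F] [CompleteSpace F]

theorem adjoint_comp_self_nonneg (B : E →L[ℂ] F) : 0 ≤ adjoint B ∘L B :=
  (nonneg_iff_isPositive _).2 (isPositive_adjoint_comp_self B)

theorem self_comp_adjoint_nonneg (B : E →L[ℂ] F) : 0 ≤ B ∘L adjoint B :=
  (nonneg_iff_isPositive _).2 (isPositive_self_comp_adjoint B)

theorem conj_nonneg {X : E →L[ℂ] E} (hX : 0 ≤ X) (B : E →L[ℂ] F) :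
    0 ≤ B ∘L X ∘L adjoint B :=
  (nonneg_iff_isPositive _).2 (((nonneg_iff_isPositive _).1 hX).conj_adjoint B)

/-- A positive operator has a self-adjoint square root. -/
theorem exists_sqrt {X : E →L[ℂ] E} (hX : 0 ≤ X) :
    ∃ R : E →L[ℂ] E, adjoint R = R ∧ R ∘L R = X := by
  refine ⟨CFC.sqrt X, ?_, CFC.sqrt_mul_sqrt_self X hX⟩
  have h1 : IsSelfAdjoint (CFC.sqrt X) := (CFC.sqrt_nonneg X).isSelfAdjoint
  exact h1.star_eq

theorem trace_adjoint_comp_self {ι : Type*} (b : HilbertBasis ι ℂ E) (B : E →L[ℂ] F) :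
    trace (adjoint B ∘L B) = ∑' i, ENNReal.ofReal (‖B (b i)‖ ^ 2) := by
  rw [trace_eq_tsum b (adjoint_comp_self_nonneg B)]
  refine tsum_congr fun i => ?_
  rw [comp_apply, adjoint_inner_right, inner_self_eq_norm_sq]

/-- Both sides are the Hilbert–Schmidt sum of `|⟪c i, B (b j)⟫|²`, summed in the two orders. -/
theorem trace_comp_adjoint (B : E →L[ℂ] F) :
    trace (B ∘L adjoint B) = trace (adjoint B ∘L B) := by
  obtain ⟨s, b, -⟩ := exists_hilbertBasis ℂ E
  obtain ⟨s', c, -⟩ := exists_hilbertBasis ℂ F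
  have h := trace_adjoint_comp_self c (adjoint B)
  rw [adjoint_adjoint] at h
  rw [h, trace_adjoint_comp_self b, tsum_congr fun i => ofReal_norm_sq_eq_tsum b _,
    tsum_congr fun j => ofReal_norm_sq_eq_tsum c (B (b j)), ENNReal.tsum_comm]
  refine tsum_congr fun j => tsum_congr fun i => ?_
  rw [adjoint_inner_right, norm_inner_symm]

theorem trace_add {X Y : E →L[ℂ] E} (hX : 0 ≤ X) (hY : 0 ≤ Y) :
    trace (X + Y) = trace X + trace Y := by
  rw [trace, trace, trace, ← ENNReal.tsum_add]
  refine tsum_congr fun e => ?_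
  rw [add_apply, inner_add_right, map_add, ENNReal.ofReal_add]
  · exact ((nonneg_iff_isPositive _).1 hX).re_inner_nonneg_right _
  · exact ((nonneg_iff_isPositive _).1 hY).re_inner_nonneg_right _

theorem trace_zero : trace (0 : E →L[ℂ] E) = 0 := by
  simp [trace]

theorem trace_sum {ι : Type*} (s : Finset ι) {X : ι → E →L[ℂ] E} (hX : ∀ i, 0 ≤ X i) :
    trace (∑ i ∈ s, X i) = ∑ i ∈ s, trace (X i) := by
  classical
  induction s using Finset.induction_on with
  | empty => simp [trace_zero]
  | insert i s hi ih =>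
    rw [Finset.sum_insert hi, Finset.sum_insert hi,
      trace_add (hX i) (Finset.sum_nonneg fun j _ => hX j), ih]

/-- Compressing a positive operator by a contraction does not increase the trace. -/
theorem trace_conj_le {X : E →L[ℂ] E} (hX : 0 ≤ X) (B : E →L[ℂ] F) (hB : ‖B‖ ≤ 1) :
    trace (B ∘L X ∘L adjoint B) ≤ trace X := by
  obtain ⟨R, hRs, hR⟩ := exists_sqrt hX
  obtain ⟨s, b, -⟩ := exists_hilbertBasis ℂ E
  have h1 : B ∘L X ∘L adjoint B = (B ∘L R) ∘L adjoint (B ∘L R) := by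
    rw [adjoint_comp, hRs, ← hR]; rfl
  have h2 : X = adjoint R ∘L R := by rw [hRs, hR]
  rw [h1, trace_comp_adjoint, trace_adjoint_comp_self b]
  conv_rhs => rw [h2]
  rw [trace_adjoint_comp_self b]
  refine ENNReal.tsum_le_tsum fun i => ENNReal.ofReal_le_ofReal ?_
  have h3 : ‖B (R (b i))‖ ≤ ‖R (b i)‖ := by
    simpa using B.le_of_opNorm_le hB (R (b i))
  exact pow_le_pow_left₀ (norm_nonneg _) h3 2

theorem trace_conj_of_isometry {X : E →L[ℂ] E} (hX : 0 ≤ X) (B : E →L[ℂ] F)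
    (hB : adjoint B ∘L B = 1) : trace (B ∘L X ∘L adjoint B) = trace X := by
  obtain ⟨R, hRs, hR⟩ := exists_sqrt hX
  have h1 : B ∘L X ∘L adjoint B = (B ∘L R) ∘L adjoint (B ∘L R) := by
    rw [adjoint_comp, hRs, ← hR]; rfl
  have h2 : adjoint (B ∘L R) ∘L (B ∘L R) = R ∘L (adjoint B ∘L B) ∘L R := by
    rw [adjoint_comp, hRs]; rfl
  rw [h1, trace_comp_adjoint, h2, hB]
  congr 1

theorem apply_eq_zero_of_re_inner_eq_zero {X : E →L[ℂ] E} (hX : 0 ≤ X) {x : E}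
    (h : RCLike.re ⟪x, X x⟫_ℂ = 0) : X x = 0 := by
  obtain ⟨R, hRs, hR⟩ := exists_sqrt hX
  rw [← hR, comp_apply, ← adjoint_inner_left, hRs, inner_self_eq_norm_sq] at h
  have : R x = 0 := by simpa using h
  rw [← hR, comp_apply, this, map_zero]

theorem rank_add_le (X Y : E →L[ℂ] E) : rank (X + Y) ≤ rank X + rank Y := by
  unfold rank
  rw [← map_add]
  exact Cardinal.toENat.monotone' (LinearMap.rank_add_le _ _)

theorem rank_zero : rank (0 : E →L[ℂ] E) = 0 := by
  simp [rank]

theorem rank_sum_le {ι : Type*} (s : Finset ι) (X : ι → E →L[ℂ] E) :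
    rank (∑ i ∈ s, X i) ≤ ∑ i ∈ s, rank (X i) := by
  classical
  induction s using Finset.induction_on with
  | empty => simp [rank_zero]
  | insert i s hi ih =>
    rw [Finset.sum_insert hi, Finset.sum_insert hi]
    exact (rank_add_le _ _).trans (by gcongr)

theorem rank_conj_le (X : E →L[ℂ] E) (B : E →L[ℂ] F) (C : F →L[ℂ] E) :
    rank (B ∘L X ∘L C) ≤ rank X := by
  refine Cardinal.toENat.monotone' ?_
  exact (LinearMap.rank_comp_le_right ((X : E →ₗ[ℂ] E) ∘ₗ (C : F →ₗ[ℂ] E)) (B : E →ₗ[ℂ] F)).trans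
    (LinearMap.rank_comp_le_left (C : F →ₗ[ℂ] E) (X : E →ₗ[ℂ] E))

theorem rank_eq_rank_quotient_ker (X : E →ₗ[ℂ] F) :
    LinearMap.rank X = Module.rank ℂ (E ⧸ LinearMap.ker X) :=
  (LinearMap.quotKerEquivRange X).rank_eq.symm

/-- If `(X + Y) x = 0`, both nonnegative quadratic forms vanish at `x`, hence `X x = 0`. So `E ⧸ ker
(X + Y)` surjects onto `E ⧸ ker X`. -/
theorem rank_le_rank_add {X Y : E →L[ℂ] E} (hX : 0 ≤ X) (hY : 0 ≤ Y) :
    rank X ≤ rank (X + Y) := by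
  have hker : LinearMap.ker ((X + Y : E →L[ℂ] E) : E →ₗ[ℂ] E) ≤ LinearMap.ker (X : E →ₗ[ℂ] E) := by
    intro x hx
    have hx' : (X + Y) x = 0 := hx
    have h1 := ((nonneg_iff_isPositive _).1 hX).re_inner_nonneg_right x
    have h2 := ((nonneg_iff_isPositive _).1 hY).re_inner_nonneg_right x
    have h3 : RCLike.re ⟪x, X x⟫_ℂ + RCLike.re ⟪x, Y x⟫_ℂ = 0 := by
      rw [← map_add, ← inner_add_right, ← add_apply, hx', inner_zero_right, map_zero]
    exact apply_eq_zero_of_re_inner_eq_zero hX (by linarith)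
  refine Cardinal.toENat.monotone' ?_
  rw [rank_eq_rank_quotient_ker, rank_eq_rank_quotient_ker]
  exact LinearMap.rank_le_of_surjective (Submodule.factor hker) (Submodule.factor_surjective hker)

/-- The dimension of a Hilbert space is the cardinality of a Hilbert basis, in `ℕ∞`. -/
theorem toENat_rank_eq_card {ι : Type u} (b : HilbertBasis ι ℂ E) :
    Cardinal.toENat (Module.rank ℂ E) = ENat.card ι := by
  cases finite_or_infinite ι with
  | inl h =>
    have := Fintype.ofFinite ι
    have hb := b.toOrthonormalBasis.toBasis.mk_eq_rank''
    rw [← hb]; rfl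
  | inr h =>
    -- The algebraic dimension may exceed the cardinality of `ι`, but `toENat` sends every infinite
    -- cardinal to `⊤`.
    have h1 : Cardinal.mk ι ≤ Module.rank ℂ E :=
      b.orthonormal.linearIndependent.cardinal_le_rank
    have h2 : Cardinal.toENat (Cardinal.mk ι) = ⊤ := by simp
    have h3 := Cardinal.toENat.monotone' h1
    rw [ENat.card_eq_top_of_infinite]
    exact top_le_iff.1 (h2 ▸ h3)

/-- The trace of an orthogonal projection is its rank. -/
theorem trace_eq_rank_of_isStarProjection {P : E →L[ℂ] E} (hP : IsStarProjection P) :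
    trace P = (rank P : ℝ≥0∞) := by
  obtain ⟨L, hL, rfl⟩ := isStarProjection_iff_eq_starProjection.1 hP
  have : CompleteSpace L := by
    rw [← L.orthogonal_orthogonal]
    exact (Submodule.isClosed_orthogonal _).completeSpace_coe
  obtain ⟨s, b, -⟩ := exists_hilbertBasis ℂ L
  -- Swapping the factors under the trace moves the sum to a basis of `L`, where each vector
  -- contributes `1`.
  have h1 : L.starProjection = L.subtypeL ∘L adjoint L.subtypeL := by
    rw [Submodule.adjoint_subtypeL]; rfl
  have h2 : rank L.starProjection = ENat.card s := by
    rw [← toENat_rank_eq_card b, rank, LinearMap.rank]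
    have : LinearMap.range (L.starProjection : E →ₗ[ℂ] E) = L := L.range_starProjection
    rw [this]
  rw [h2, h1, trace_comp_adjoint, trace_adjoint_comp_self b]
  have h3 : ∀ i, ENNReal.ofReal (‖L.subtypeL (b i)‖ ^ 2) = 1 := by
    intro i
    have : ‖L.subtypeL (b i)‖ = 1 := b.orthonormal.1 i
    rw [this, one_pow, ENNReal.ofReal_one]
  rw [tsum_congr h3, ENNReal.tsum_one]

end TraceRank

/-! ### Defect operators and existence of the limits -/

section Defect

variable {H : Type u} [NormedAddCommGroup H] [InnerProductSpace ℂ H] [CompleteSpace H]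
variable {n : ℕ}

theorem Phi_sub (A : Fin n → H →L[ℂ] H) (X Y : H →L[ℂ] H) :
    Phi A (X - Y) = Phi A X - Phi A Y := by
  simp [Phi, mul_sub, sub_mul]

theorem Phi_nonneg (A : Fin n → H →L[ℂ] H) {X : H →L[ℂ] H} (hX : 0 ≤ X) : 0 ≤ Phi A X :=
  Finset.sum_nonneg fun i _ => conj_nonneg hX (A i)

theorem defect_zero (A : Fin n → H →L[ℂ] H) : defect A 0 = 0 := by
  simp [defect]

theorem defect_one (A : Fin n → H →L[ℂ] H) : defect A 1 = 1 - ∑ i, A i * adjoint (A i) := by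
  simp [defect, Phi]

theorem defect_succ (A : Fin n → H →L[ℂ] H) (k : ℕ) :
    defect A (k + 1) = defect A 1 + Phi A (defect A k) := by
  simp only [defect, Phi_sub, Function.iterate_succ_apply', Function.iterate_zero, id]
  abel

theorem defect_one_nonneg {A : Fin n → H →L[ℂ] H} (hA : IsContractive A) : 0 ≤ defect A 1 := by
  rw [defect_one]
  exact sub_nonneg.2 hA

theorem defect_nonneg {A : Fin n → H →L[ℂ] H} (hA : IsContractive A) (k : ℕ) :
    0 ≤ defect A k := by
  induction k with
  | zero => rw [defect_zero]
  | succ k ih => rw [defect_succ]; exact add_nonneg (defect_one_nonneg hA) (Phi_nonneg A ih)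

theorem IsContractive.norm_le_one {A : Fin n → H →L[ℂ] H} (hA : IsContractive A) (i : Fin n) :
    ‖A i‖ ≤ 1 := by
  have h1 : A i * adjoint (A i) ≤ 1 :=
    (Finset.single_le_sum (fun j _ => self_comp_adjoint_nonneg (A j)) (Finset.mem_univ i)).trans hA
  have h2 : ‖A i * star (A i)‖ ≤ 1 :=
    (CStarAlgebra.norm_le_one_iff_of_nonneg _ (self_comp_adjoint_nonneg (A i))).2 h1
  rw [CStarRing.norm_self_mul_star] at h2
  nlinarith [norm_nonneg (A i)]

theorem trace_Phi (A : Fin n → H →L[ℂ] H) {X : H →L[ℂ] H} (hX : 0 ≤ X) :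
    trace (Phi A X) = ∑ i, trace (A i ∘L X ∘L adjoint (A i)) :=
  trace_sum _ fun i => conj_nonneg hX (A i)

theorem trace_Phi_le {A : Fin n → H →L[ℂ] H} (hA : IsContractive A) {X : H →L[ℂ] H}
    (hX : 0 ≤ X) : trace (Phi A X) ≤ n * trace X := by
  rw [trace_Phi A hX]
  calc ∑ i, trace (A i ∘L X ∘L adjoint (A i)) ≤ ∑ _i : Fin n, trace X :=
        Finset.sum_le_sum fun i _ => trace_conj_le hX (A i) (hA.norm_le_one i)
    _ = n * trace X := by simp

theorem rank_Phi_le (A : Fin n → H →L[ℂ] H) (X : H →L[ℂ] H) :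
    rank (Phi A X) ≤ n * rank X := by
  calc rank (Phi A X) ≤ ∑ i, rank (A i * X * adjoint (A i)) := rank_sum_le _ _
    _ ≤ ∑ _i : Fin n, rank X := Finset.sum_le_sum fun i _ => rank_conj_le X (A i) _
    _ = n * rank X := by simp

theorem tendsto_curvature (hn : 2 ≤ n) {A : Fin n → H →L[ℂ] H} (hA : IsContractive A) :
    Tendsto (curvatureSeq A) atTop (𝓝 (curvature A)) := by
  refine tendsto_nhds_limUnder (exists_tendsto_of_le_add_mul hn (t := fun k => trace (defect A k))
    (fun k => ?_) fun k => ?_)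
  all_goals
    have h := trace_add (defect_one_nonneg hA) (Phi_nonneg A (defect_nonneg hA k))
    rw [defect_succ A k, h]
  · exact add_le_add_right (trace_Phi_le hA (defect_nonneg hA k)) _
  · exact le_self_add

theorem tendsto_eulerChar (hn : 2 ≤ n) {A : Fin n → H →L[ℂ] H} (hA : IsContractive A) :
    Tendsto (eulerSeq A) atTop (𝓝 (eulerChar A)) := by
  refine tendsto_nhds_limUnder (exists_tendsto_of_le_add_mul hn
    (t := fun k => (rank (defect A k) : ℝ≥0∞)) (fun k => ?_) fun k => ?_)
  · have h : rank (defect A (k + 1)) ≤ rank (defect A 1) + n * rank (defect A k) := by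
      rw [defect_succ A k]
      exact (rank_add_le _ _).trans (add_le_add_right (rank_Phi_le A _) _)
    simpa using ENat.toENNReal_le.2 h
  · rw [defect_succ A k]
    exact ENat.toENNReal_le.2
      (rank_le_rank_add (defect_one_nonneg hA) (Phi_nonneg A (defect_nonneg hA k)))

end Defect

/-! ### Tuples of isometries with orthogonal ranges -/

section Isometric

variable {K : Type u} [NormedAddCommGroup K] [InnerProductSpace ℂ K] [CompleteSpace K]
variable {n : ℕ} {S : Fin n → K →L[ℂ] K}

/-- The relations `S_i* S_j = δ_ij` kill the cross terms, leaving a sum of mutually orthogonal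
projections. -/
theorem isStarProjection_Phi (hS : ∀ i j, adjoint (S i) * S j = if i = j then 1 else 0)
    {X : K →L[ℂ] K} (hX : IsStarProjection X) : IsStarProjection (Phi S X) := by
  refine ⟨?_, ?_⟩
  · have h : ∀ i j, S i * X * adjoint (S i) * (S j * X * adjoint (S j)) =
        if i = j then S i * X * adjoint (S i) else 0 := by
      intro i j
      calc S i * X * adjoint (S i) * (S j * X * adjoint (S j))
          = S i * X * (adjoint (S i) * S j) * X * adjoint (S j) := by noncomm_ring
        _ = if i = j then S i * X * adjoint (S i) else 0 := by
          rw [hS]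
          split_ifs with hij
          · subst hij
            rw [mul_one, mul_assoc (S i), hX.isIdempotentElem.eq]
          · simp
    simp only [IsIdempotentElem, Phi, Finset.sum_mul_sum, h]
    simp
  · have hX' : star X = X := hX.isSelfAdjoint
    simp only [IsSelfAdjoint, Phi, ← star_eq_adjoint, star_sum, star_mul, star_star, hX', mul_assoc]

theorem isStarProjection_defect (hS : ∀ i j, adjoint (S i) * S j = if i = j then 1 else 0)
    (k : ℕ) : IsStarProjection (defect S k) := by
  refine IsStarProjection.one_sub ?_
  induction k with
  | zero => exact IsStarProjection.one _
  | succ k ih => rw [Function.iterate_succ_apply']; exact isStarProjection_Phi hS ih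

theorem defect_nonneg_of_isometric (hS : ∀ i j, adjoint (S i) * S j = if i = j then 1 else 0)
    (k : ℕ) : 0 ≤ defect S k :=
  (isStarProjection_defect hS k).nonneg

theorem isContractive_of_isometric (hS : ∀ i j, adjoint (S i) * S j = if i = j then 1 else 0) :
    IsContractive S :=
  sub_nonneg.1 (defect_one S ▸ defect_nonneg_of_isometric hS 1)

theorem trace_defect_succ (hS : ∀ i j, adjoint (S i) * S j = if i = j then 1 else 0) (k : ℕ) :
    trace (defect S (k + 1)) = (rank (defect S 1) : ℝ≥0∞) + n * trace (defect S k) := by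
  have hk := defect_nonneg_of_isometric hS k
  rw [defect_succ, trace_add (defect_nonneg_of_isometric hS 1) (Phi_nonneg S hk),
    trace_eq_rank_of_isStarProjection (isStarProjection_defect hS 1), trace_Phi S hk]
  congr 1
  calc ∑ i, trace (S i ∘L defect S k ∘L adjoint (S i)) = ∑ _i : Fin n, trace (defect S k) :=
        Finset.sum_congr rfl fun i _ =>
          trace_conj_of_isometry hk (S i) ((hS i i).trans (if_pos rfl))
    _ = n * trace (defect S k) := by simp

theorem eulerSeq_eq_curvatureSeq (hS : ∀ i j, adjoint (S i) * S j = if i = j then 1 else 0) :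
    eulerSeq S = curvatureSeq S := by
  funext k
  rw [eulerSeq, curvatureSeq, trace_eq_rank_of_isStarProjection (isStarProjection_defect hS k)]

theorem curvature_eq_rank (hn : 2 ≤ n)
    (hS : ∀ i j, adjoint (S i) * S j = if i = j then 1 else 0) :
    curvature S = (rank (defect S 1) : ℝ≥0∞) :=
  Tendsto.limUnder_eq (tendsto_of_eq_add_mul hn (t := fun k => trace (defect S k))
    (by simp [defect_zero, trace_zero]) (trace_defect_succ hS))

theorem eulerChar_eq_curvature (hS : ∀ i j, adjoint (S i) * S j = if i = j then 1 else 0) :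
    eulerChar S = curvature S := by
  rw [eulerChar, eulerSeq_eq_curvatureSeq hS, curvature]

/-- Consequently, in the dense span of the `S_w H`, only the empty word survives the projection
`defect S 1`. -/
theorem defect_one_mul (hS : ∀ i j, adjoint (S i) * S j = if i = j then 1 else 0) (i : Fin n) :
    defect S 1 * S i = 0 := by
  rw [defect_one, sub_mul, Finset.sum_mul]
  simp [mul_assoc, hS]

end Isometric

/-! ### Comparison of `A` with its minimal dilation -/

section Dilation

variable {H : Type u} [NormedAddCommGroup H] [InnerProductSpace ℂ H] [CompleteSpace H]
variable {K : Type u} [NormedAddCommGroup K] [InnerProductSpace ℂ K] [CompleteSpace K]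
variable {n : ℕ} {A : Fin n → H →L[ℂ] H} {S : Fin n → K →L[ℂ] K} {V : H →ₗᵢ[ℂ] K}

theorem wordOp_cons (A : Fin n → H →L[ℂ] H) (i : Fin n) (w : List (Fin n)) :
    wordOp A (i :: w) = A i * wordOp A w := by
  simp [wordOp]

theorem adjoint_comp_self_eq_one (V : H →ₗᵢ[ℂ] K) :
    adjoint V.toContinuousLinearMap ∘L V.toContinuousLinearMap = 1 := by
  ext h
  refine ext_inner_left ℂ fun h' => ?_
  rw [comp_apply, adjoint_inner_right]
  exact V.inner_map_map h' h

namespace IsMinimalIsometricDilation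

theorem inner_wordOp (hS : IsMinimalIsometricDilation A S V) (w : List (Fin n)) (h h' : H) :
    ⟪V h, wordOp S w (V h')⟫_ℂ = ⟪h, wordOp A w h'⟫_ℂ := by
  rw [← hS.compression w, comp_apply, adjoint_inner_right]
  rfl

/-- A closed subspace containing all `S_w V h` is the whole space. -/
theorem eq_top_of_isClosed (hS : IsMinimalIsometricDilation A S V) {M : Submodule ℂ K}
    (hM : IsClosed (M : Set K)) (h : ∀ w h, wordOp S w (V h) ∈ M) : M = ⊤ := by
  rw [← top_le_iff, ← hS.minimal]
  refine Submodule.topologicalClosure_minimal _ (Submodule.span_le.2 ?_) hM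
  rintro x ⟨w, h', rfl⟩
  exact h w h'

/-- `H` is invariant under the adjoints `S_i*`, which restrict to `A_i*`. -/
theorem adjoint_apply (hS : IsMinimalIsometricDilation A S V) (i : Fin n) (h : H) :
    adjoint (S i) (V h) = V (adjoint (A i) h) := by
  refine ext_inner_right ℂ fun x => ?_
  -- By minimality it suffices to test against `S_w V h'`; moving `S_i*` across prepends the letter
  -- `i` to `w`, where the compression property applies.
  have h1 : LinearMap.ker ((innerSL ℂ (adjoint (S i) (V h) - V (adjoint (A i) h)) :
      K →L[ℂ] ℂ) : K →ₗ[ℂ] ℂ) = ⊤ := by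
    refine hS.eq_top_of_isClosed (ContinuousLinearMap.isClosed_ker _) fun w h' => ?_
    change ⟪adjoint (S i) (V h) - V (adjoint (A i) h), wordOp S w (V h')⟫_ℂ = 0
    rw [inner_sub_left, hS.inner_wordOp, adjoint_inner_left, adjoint_inner_left,
      ← mul_apply_eq_comp, ← wordOp_cons, hS.inner_wordOp, wordOp_cons, mul_apply_eq_comp, sub_self]
  have h2 : ⟪adjoint (S i) (V h) - V (adjoint (A i) h), x⟫_ℂ = 0 := Submodule.eq_top_iff'.1 h1 x
  rwa [inner_sub_left, sub_eq_zero] at h2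

theorem conj_Phi (hS : IsMinimalIsometricDilation A S V) {X : K →L[ℂ] K} {Y : H →L[ℂ] H}
    (hX : adjoint V.toContinuousLinearMap ∘L X ∘L V.toContinuousLinearMap = Y) :
    adjoint V.toContinuousLinearMap ∘L Phi S X ∘L V.toContinuousLinearMap = Phi A Y := by
  ext h
  refine ext_inner_left ℂ fun h' => ?_
  have key : ∀ i, ⟪V h', S i (X (adjoint (S i) (V h)))⟫_ℂ = ⟪h', A i (Y (adjoint (A i) h))⟫_ℂ := by
    intro i
    rw [← adjoint_inner_left, hS.adjoint_apply, hS.adjoint_apply, ← adjoint_inner_left (A i), ← hX,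
      comp_apply, adjoint_inner_right]
    rfl
  rw [comp_apply, adjoint_inner_right]
  simp only [Phi, comp_apply, sum_apply, inner_sum]
  exact Finset.sum_congr rfl fun i _ => key i

theorem conj_defect (hS : IsMinimalIsometricDilation A S V) (k : ℕ) :
    adjoint V.toContinuousLinearMap ∘L defect S k ∘L V.toContinuousLinearMap = defect A k := by
  have h1 : adjoint V.toContinuousLinearMap ∘L (Phi S)^[k] 1 ∘L V.toContinuousLinearMap =
      (Phi A)^[k] 1 := by
    induction k with
    | zero => exact adjoint_comp_self_eq_one V
    | succ k ih =>
      rw [Function.iterate_succ_apply', Function.iterate_succ_apply']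
      exact hS.conj_Phi ih
  rw [defect, defect, ← h1, sub_comp, comp_sub]
  congr 1
  exact adjoint_comp_self_eq_one V

theorem curvatureSeq_le (hS : IsMinimalIsometricDilation A S V) (k : ℕ) :
    curvatureSeq A k ≤ curvatureSeq S k := by
  have h1 : ‖adjoint V.toContinuousLinearMap‖ ≤ 1 := by
    rw [LinearIsometryEquiv.norm_map]
    exact V.norm_toContinuousLinearMap_le
  have h2 := trace_conj_le (defect_nonneg_of_isometric hS.isometric k) _ h1
  rw [adjoint_adjoint, hS.conj_defect] at h2
  unfold curvatureSeq
  gcongr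

theorem eulerSeq_le (hS : IsMinimalIsometricDilation A S V) (k : ℕ) :
    eulerSeq A k ≤ eulerSeq S k := by
  have h : rank (defect A k) ≤ rank (defect S k) :=
    hS.conj_defect k ▸ rank_conj_le (defect S k) _ _
  unfold eulerSeq
  gcongr

/-- The wandering subspace of the minimal isometric dilation of `A` has the dimension of the
range of `I - ∑ i, A_i A_i*`. -/
theorem rank_defect_one (hS : IsMinimalIsometricDilation A S V) :
    rank (defect S 1) = rank (defect A 1) := by
  refine le_antisymm ?_ (hS.conj_defect 1 ▸ rank_conj_le (defect S 1) _ _)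
  set P := defect S 1 with hP
  have hproj : IsStarProjection P := isStarProjection_defect hS.isometric 1
  -- `C* C = defect A 1`, so `C` has the rank of `defect A 1`; it remains to compare the ranges of
  -- `P` and `C`.
  set C : H →L[ℂ] K := P ∘L V.toContinuousLinearMap with hC
  set B : H →ₗ[ℂ] K := (C : H →ₗ[ℂ] K)
  have hCC : adjoint C ∘L C = defect A 1 := by
    have hadj : adjoint P = P := hproj.isSelfAdjoint
    have hidem : P ∘L P = P := hproj.isIdempotentElem
    rw [← hS.conj_defect 1, hC, adjoint_comp, hadj, comp_assoc, ← comp_assoc P P, hidem]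
  have hker : LinearMap.ker B = LinearMap.ker (defect A 1 : H →ₗ[ℂ] H) :=
    hCC ▸ (ker_adjoint_comp_self C).symm
  have hrank : LinearMap.rank B = LinearMap.rank (defect A 1 : H →ₗ[ℂ] H) := by
    rw [rank_eq_rank_quotient_ker, rank_eq_rank_quotient_ker, hker]
  by_cases hfin : LinearMap.rank B < Cardinal.aleph0
  · have : FiniteDimensional ℂ (LinearMap.range B) := Module.rank_lt_aleph0_iff.1 hfin
    -- A finite-dimensional range is closed, so its preimage under `P` is a closed subspace; it
    -- contains every `S_w V h`, since `P` kills those with `w` nonempty.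
    have htop : (LinearMap.range B).comap (P : K →ₗ[ℂ] K) = ⊤ := by
      refine hS.eq_top_of_isClosed
        ((Submodule.closed_of_finiteDimensional (LinearMap.range B)).preimage P.continuous) ?_
      intro w h
      change P (wordOp S w (V h)) ∈ LinearMap.range B
      cases w with
      | nil => exact ⟨h, rfl⟩
      | cons i w =>
        rw [wordOp_cons, ← mul_apply_eq_comp, ← mul_assoc, hP, defect_one_mul hS.isometric, zero_mul]
        exact Submodule.zero_mem _
    refine Cardinal.toENat.monotone' ?_
    rw [← hrank]
    refine Submodule.rank_mono ?_
    rintro _ ⟨x, rfl⟩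
    exact Submodule.eq_top_iff'.1 htop x
  · rw [rank, rank, ← hrank, Cardinal.toENat_eq_top.2 (not_lt.1 hfin)]
    exact le_top

/-- Every minimal dilation yields the rank of `defect A 1`, so the supremum is over a single value
and no unitary equivalence between dilations is needed. -/
theorem pureRank_eq (hS : IsMinimalIsometricDilation A S V) :
    pureRank A = rank (defect S 1) := by
  refine le_antisymm (sSup_le ?_) (le_sSup ⟨K, _, _, _, S, V, hS, by rw [defect_one]⟩)
  rintro r ⟨K', _, _, _, S', V', hS', rfl⟩
  rw [← defect_one, hS'.rank_defect_one, hS.rank_defect_one]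

end IsMinimalIsometricDilation

end Dilation

end RowContraction

theorem mainTheorem3 {n : ℕ} (hn : 2 ≤ n)
    {H : Type u} [NormedAddCommGroup H] [InnerProductSpace ℂ H] [CompleteSpace H]
    {K : Type u} [NormedAddCommGroup K] [InnerProductSpace ℂ K] [CompleteSpace K]
    (A : Fin n → H →L[ℂ] H) (hA : RowContraction.IsContractive A)
    (S : Fin n → K →L[ℂ] K) (V : H →ₗᵢ[ℂ] K)
    (hS : RowContraction.IsMinimalIsometricDilation A S V) :
    -- the limits that define `K(A)`, `K(S)`, `χ(A)`, `χ(S)` exist in `[0, ∞]`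
    (Tendsto (RowContraction.curvatureSeq A) atTop (𝓝 (RowContraction.curvature A)) ∧
      Tendsto (RowContraction.curvatureSeq S) atTop (𝓝 (RowContraction.curvature S)) ∧
      Tendsto (RowContraction.eulerSeq A) atTop (𝓝 (RowContraction.eulerChar A)) ∧
      Tendsto (RowContraction.eulerSeq S) atTop (𝓝 (RowContraction.eulerChar S))) ∧
    -- (i)
    (RowContraction.curvature A ≤ RowContraction.curvature S ∧
      RowContraction.curvature S = (RowContraction.pureRank A : ℝ≥0∞)) ∧
    -- (ii)
    (RowContraction.eulerChar A ≤ RowContraction.eulerChar S ∧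
      RowContraction.eulerChar S = (RowContraction.pureRank A : ℝ≥0∞)) := by
  have hc : RowContraction.curvature S = (RowContraction.pureRank A : ℝ≥0∞) := by
    rw [hS.pureRank_eq, RowContraction.curvature_eq_rank hn hS.isometric]
  have hS' := RowContraction.isContractive_of_isometric hS.isometric
  have h1 := RowContraction.tendsto_curvature hn hA
  have h2 := RowContraction.tendsto_curvature hn hS'
  have h3 := RowContraction.tendsto_eulerChar hn hA
  have h4 := RowContraction.tendsto_eulerChar hn hS'
  exact ⟨⟨h1, h2, h3, h4⟩, ⟨le_of_tendsto_of_tendsto' h1 h2 hS.curvatureSeq_le, hc⟩,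
    ⟨le_of_tendsto_of_tendsto' h3 h4 hS.eulerSeq_le,
      (RowContraction.eulerChar_eq_curvature hS.isometric).trans hc⟩⟩
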